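/- Let $I=[0,1]$, $f(x)=4x(1-x)$ and $g(x)=\sin(\pi x)$ for $x\in I$. For a $C^1$ map $F:I\to I$ let $\lambda_-(F,x)=\liminf_{n\to\infty}\frac1n\log|DF^n(x)|\in[-\infty,\infty]$ (with $\log 0=-\infty$) be the lower pointwise Lyapunov exponent at $x\in I$. Then $f$ and $g$ are $C^3$ unimodal maps of $I$: each maps $I$ into $I$ and $\partial I$ into $\partial I$, is strictly monotone on either side of an interior turning point, with opposite monotonicity on the two sides, and this turning point $c$ is its only critical point and is non-flat, i.e. there are $\ell\ge 2$ and $K>0$ with $\frac1K\le\frac{|F(x)-F(c)|}{|x-c|^{\ell}}\le K$ for all $x\in I\setminus\{c\}$ ($F=f$ or $F=g$). Moreover, there exist a homeomorphism $h:I\to I$ with $h\circ f=g\circ h$ and a point $y\in I$ such that $$\lambda_-(f,y)<0<\lambda_-(g,h(y)),$$ and such that neither $y$ under $f$ nor $h(y)$ under $g$ is asymptotic to a neutral periodic orbit. Here $x$ is asymptotic to a neutral periodic orbit of $F$ if there are $q\in I$ and $p\ge1$ with $F^p(q)=q$, $|DF^p(q)|=1$ and $|F^n(x)-F^n(q)|\to0$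 as $n\to\infty$. In particular, the sign of the lower pointwise Lyapunov exponent of a point is not preserved under topological conjugacy of unimodal maps, and this is not restricted to orbits asymptotic to neutral periodic orbits. -/

import Mathlib

open Set Filter Topology

noncomputable section

/-- The map `f` has a non-flat critical point at `c`, as a map of the interval `[a, b]`:
`|f x - f c|` is comparable with `|x - c| ^ ℓ` for some real `ℓ ≥ 2`. -/
def IsNonflatAt (f : ℝ → ℝ) (a b c : ℝ) : Prop :=
  ∃ ℓ K : ℝ, 2 ≤ ℓ ∧ 0 < K ∧ ∀ x ∈ Icc a b, x ≠ c →
    1 / K ≤ |f x - f c| / |x - c| ^ ℓ ∧ |f x - f c| / |x - c| ^ ℓ ≤ K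

/-- `f` restricts to a `C^3` unimodal self-map of the compact interval `[a, b]` which maps the
boundary of the interval into itself and whose only critical point, the turning point, is an
interior point and is non-flat. Derivatives are derivatives of the map of `[a, b]`. -/
structure IsUnimodal (f : ℝ → ℝ) (a b : ℝ) : Prop where
  mapsTo : MapsTo f (Icc a b) (Icc a b)
  mapsTo_boundary : MapsTo f {a, b} {a, b}
  contDiffOn : ContDiffOn ℝ 3 f (Icc a b)
  exists_turning : ∃ c ∈ Ioo a b,
    ((StrictMonoOn f (Icc a c) ∧ StrictAntiOn f (Icc c b)) ∨
      (StrictAntiOn f (Icc a c) ∧ StrictMonoOn f (Icc c b))) ∧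
    {x ∈ Icc a b | derivWithin f (Icc a b) x = 0} = {c} ∧
    IsNonflatAt f a b c

/-- The homeomorphism `h : I → J` is a topological conjugacy between `f : I → I` and
`g : J → J`, that is, `h ∘ f = g ∘ h`. -/
def IsTopConjugacy {I J : Set ℝ} (f g : ℝ → ℝ) (h : I ≃ₜ J) : Prop :=
  ∃ (hf : MapsTo f I I) (hg : MapsTo g J J),
    h ∘ hf.restrict f I I = hg.restrict g J J ∘ h

/-- The lower pointwise Lyapunov exponent `liminf (1/n) log |Df^n(x)|` of `f : I → I` at `x`,
an extended real number. Here `log 0 = -∞`. -/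
def lowerLyapunov (f : ℝ → ℝ) (I : Set ℝ) (x : ℝ) : EReal :=
  liminf (fun n : ℕ => ENNReal.log (ENNReal.ofReal |derivWithin (f^[n]) I x|) / (n : EReal)) atTop

/-- The orbit of `x` under `f : I → I` is asymptotic to a neutral periodic orbit, that is, to
the orbit of a point `q` with `f^p(q) = q` and `|Df^p(q)| = 1` for some `p ≥ 1`. -/
def IsAsymptoticToNeutral (f : ℝ → ℝ) (I : Set ℝ) (x : ℝ) : Prop :=
  ∃ q ∈ I, ∃ p : ℕ, 0 < p ∧ Function.IsPeriodicPt f p q ∧ |derivWithin (f^[p]) I q| = 1 ∧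
    Tendsto (fun n : ℕ => dist (f^[n] x) (f^[n] q)) atTop (𝓝 0)

/-- The quadratic map `x ↦ 4x(1-x)`. -/
def quadMap (x : ℝ) : ℝ := 4 * x * (1 - x)

/-- The sine map `x ↦ sin(πx)`. -/
def sineMap (x : ℝ) : ℝ := Real.sin (Real.pi * x)

end

/-! Put w(x) = x(1-x), and write f, g for the quadratic and the sine map. In the metric |dx|/√w the
map f expands by exactly 2, while g expands by at least √π, and by at least √(9π/8) at points whose
image is at least 1/2. Hence (Df^n)² w(y) = 4^n w(f^n y), and (Dg^n)² ≥ π^n (9/8)^m w(g^n z), where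
m counts the times before n with image at least 1/2.

The point y is prescribed by its itinerary: left half during [32B, 65B) for B = 8^k, right half at
all other times. To stay left for 33B steps, f^n(y) at n = 32B must lie within about 4^(-33B) of 0,
so (Df^n)² is at most a constant times 4^(-B): the exponent of f is negative
(`lowerLyapunov_quadMap_neg`). For g, whose multiplier at 0 is π, the same passage costs only a
factor π^(-33B) up to constants, against π^(32B) (9/8)^(23B) gained before, as the times [9B, 32B)
are spent on the right. Since (9/8)^23 > 4π, the gain wins (`lowerLyapunov_sineMap_pos`).

In the coordinate (2/π) arcsin √x both maps are expanding full tents, so a conjugacy preserving the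
two halves, hence itineraries, exists (`exists_isTopConjugacy_quadMap_sineMap`). The same expansion
excludes neutral periodic orbits altogether. -/

open scoped NNReal

/-! ### Unimodality of the two maps -/

theorem hasDerivAt_quadMap (x : ℝ) : HasDerivAt quadMap (4 - 8 * x) x := by
  unfold quadMap
  refine (((hasDerivAt_id x).const_mul 4).mul ((hasDerivAt_id x).const_sub 1)).congr_deriv ?_
  simp
  ring

theorem isUnimodal_quadMap : IsUnimodal quadMap 0 1 where
  mapsTo := by
    rintro x ⟨h0, h1⟩
    unfold quadMap
    constructor <;> nlinarith [mul_nonneg h0 (sub_nonneg.2 h1), sq_nonneg (2 * x - 1)]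
  mapsTo_boundary := by
    rintro x (rfl | rfl) <;> simp [quadMap]
  contDiffOn := by
    unfold quadMap
    fun_prop
  exists_turning := by
    refine ⟨1 / 2, by norm_num, Or.inl ⟨?_, ?_⟩, ?_, 2, 4, le_rfl, by norm_num, ?_⟩
    · rintro x ⟨hx0, hx1⟩ y ⟨hy0, hy1⟩ hxy
      simp only [quadMap]
      nlinarith
    · rintro x ⟨hx0, hx1⟩ y ⟨hy0, hy1⟩ hxy
      simp only [quadMap]
      nlinarith
    · ext x
      simp only [mem_ofPred_eq, mem_singleton_iff]
      constructor
      · rintro ⟨hx, h⟩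
        rw [(hasDerivAt_quadMap x).hasDerivWithinAt.derivWithin
          (uniqueDiffOn_Icc zero_lt_one x hx)] at h
        linarith
      · rintro rfl
        have hx : (1 / 2 : ℝ) ∈ Icc (0 : ℝ) 1 := by norm_num
        refine ⟨hx, ?_⟩
        rw [(hasDerivAt_quadMap _).hasDerivWithinAt.derivWithin
          (uniqueDiffOn_Icc zero_lt_one _ hx)]
        norm_num
    · intro x _ hxc
      have hpos : 0 < (x - 1 / 2) ^ 2 := by
        have := sub_ne_zero.2 hxc
        positivity
      have : |quadMap x - quadMap (1 / 2)| = 4 * (x - 1 / 2) ^ 2 := by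
        rw [abs_of_nonpos (by unfold quadMap; nlinarith)]
        unfold quadMap
        ring
      rw [this, Real.rpow_two, sq_abs, mul_div_cancel_right₀ _ hpos.ne']
      norm_num

theorem sineMap_one_sub (x : ℝ) : sineMap (1 - x) = sineMap x := by
  rw [sineMap, sineMap, mul_sub, mul_one, Real.sin_pi_sub]

theorem strictMonoOn_sineMap : StrictMonoOn sineMap (Icc 0 (1 / 2)) := by
  rintro x ⟨hx0, hx1⟩ y ⟨hy0, hy1⟩ hxy
  have := Real.pi_pos
  exact Real.strictMonoOn_sin ⟨by nlinarith, by nlinarith⟩ ⟨by nlinarith, by nlinarith⟩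
    (by nlinarith)

theorem hasDerivAt_sineMap (x : ℝ) :
    HasDerivAt sineMap (Real.pi * Real.cos (Real.pi * x)) x := by
  unfold sineMap
  refine (((hasDerivAt_id x).const_mul Real.pi).sin).congr_deriv ?_
  simp
  ring

theorem mapsTo_sineMap : MapsTo sineMap (Icc 0 1) (Icc 0 1) := by
  rintro x ⟨h0, h1⟩
  have := Real.pi_pos
  exact ⟨Real.sin_nonneg_of_nonneg_of_le_pi (by positivity) (by nlinarith), Real.sin_le_one _⟩

theorem sineMap_half : sineMap (1 / 2) = 1 := by
  rw [sineMap, mul_one_div, Real.sin_pi_div_two]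

theorem isUnimodal_sineMap : IsUnimodal sineMap 0 1 where
  mapsTo := mapsTo_sineMap
  mapsTo_boundary := by
    rintro x (rfl | rfl) <;> simp [sineMap]
  contDiffOn := by
    unfold sineMap
    fun_prop
  exists_turning := by
    have hpi := Real.pi_pos
    refine ⟨1 / 2, by norm_num, Or.inl ⟨strictMonoOn_sineMap, ?_⟩, ?_, 2, 5, le_rfl,
      by norm_num, ?_⟩
    · rintro x ⟨hx0, hx1⟩ y ⟨hy0, hy1⟩ hxy
      rw [← sineMap_one_sub x, ← sineMap_one_sub y]
      exact strictMonoOn_sineMap ⟨by linarith, by linarith⟩ ⟨by linarith, by linarith⟩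
        (by linarith)
    · ext x
      simp only [mem_ofPred_eq, mem_singleton_iff]
      constructor
      · rintro ⟨hx, h⟩
        rw [(hasDerivAt_sineMap x).hasDerivWithinAt.derivWithin
          (uniqueDiffOn_Icc zero_lt_one x hx)] at h
        have hc := (mul_eq_zero.1 h).resolve_left hpi.ne'
        have : Real.pi * x = Real.pi / 2 :=
          Real.injOn_cos ⟨by nlinarith [hx.1], by nlinarith [hx.2]⟩
            ⟨by linarith, by linarith⟩ (by rw [hc, Real.cos_pi_div_two])
        exact mul_left_cancel₀ hpi.ne' (by linarith)
      · rintro rfl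
        have hx : (1 / 2 : ℝ) ∈ Icc (0 : ℝ) 1 := by norm_num
        refine ⟨hx, ?_⟩
        rw [(hasDerivAt_sineMap _).hasDerivWithinAt.derivWithin
          (uniqueDiffOn_Icc zero_lt_one _ hx), mul_one_div, Real.cos_pi_div_two, mul_zero]
    · intro x hx hxc
      have hpos : 0 < (x - 1 / 2) ^ 2 := by
        have := sub_ne_zero.2 hxc
        positivity
      have hs : sineMap x = Real.cos (Real.pi * (x - 1 / 2)) := by
        rw [sineMap, ← Real.cos_sub_pi_div_two]
        ring_nf
      rw [sineMap_half, hs, abs_sub_comm, abs_of_nonneg (sub_nonneg.2 (Real.cos_le_one _)),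
        Real.rpow_two, sq_abs, le_div_iff₀ hpos, div_le_iff₀ hpos]
      have h1 := Real.one_sub_sq_div_two_le_cos (x := Real.pi * (x - 1 / 2))
      have h2 := Real.cos_le_one_sub_mul_cos_sq (x := Real.pi * (x - 1 / 2))
        (by rw [abs_le]; constructor <;> nlinarith [hx.1, hx.2])
      have h3 : 2 / Real.pi ^ 2 * (Real.pi * (x - 1 / 2)) ^ 2 = 2 * (x - 1 / 2) ^ 2 := by
        field_simp
      have h4 : Real.pi ^ 2 ≤ 10 := by nlinarith [Real.pi_lt_d2]
      rw [mul_pow] at h1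
      constructor <;> nlinarith

/-! ### Expansion in the metric |dx|/√(x(1-x)) -/

theorem sineMap_le_pi_mul {x : ℝ} (hx : 0 ≤ x) : sineMap x ≤ Real.pi * x :=
  Real.sin_le (mul_nonneg Real.pi_pos.le hx)

theorem sineMap_le_pi_mul_one_sub {x : ℝ} (hx : x ≤ 1) : sineMap x ≤ Real.pi * (1 - x) := by
  rw [← sineMap_one_sub]
  exact sineMap_le_pi_mul (by linarith)

theorem two_mul_le_sineMap {x : ℝ} (h0 : 0 ≤ x) (h1 : x ≤ 1 / 2) : 2 * x ≤ sineMap x := by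
  have hpi := Real.pi_pos
  have := Real.mul_le_sin (x := Real.pi * x) (by positivity) (by nlinarith)
  rwa [← mul_assoc, div_mul_cancel₀ _ hpi.ne'] at this

/-- Multiplied by π(1 - sin πx), this is the expansion estimate for the sine map. By symmetry x ≤
1/2; then sin πx ≤ πx, and sin πx ≥ 2x gives (1 + sin πx)(1 - x) ≥ 1. -/
theorem sineMap_le_mul_one_add {x : ℝ} (hx : x ∈ Icc (0 : ℝ) 1) :
    sineMap x ≤ Real.pi * (1 + sineMap x) * (x * (1 - x)) := by
  wlog h : x ≤ 1 / 2 generalizing x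
  · have := this (x := 1 - x) ⟨by linarith [hx.2], by linarith [hx.1]⟩ (by linarith)
    rw [sineMap_one_sub] at this
    linarith
  have h1 := sineMap_le_pi_mul hx.1
  have h2 := two_mul_le_sineMap hx.1 h
  have h3 : 1 ≤ (1 + sineMap x) * (1 - x) := by nlinarith [hx.1]
  nlinarith [mul_le_mul_of_nonneg_left h3 (mul_nonneg Real.pi_pos.le hx.1)]

theorem sineMap_le_mul_one_add_of_half_le {x : ℝ} (hx : x ∈ Icc (0 : ℝ) 1)
    (hs : 1 / 2 ≤ sineMap x) :
    9 / 8 * sineMap x ≤ Real.pi * (1 + sineMap x) * (x * (1 - x)) := by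
  wlog h : x ≤ 1 / 2 generalizing x
  · have := this (x := 1 - x) ⟨by linarith [hx.2], by linarith [hx.1]⟩
      (by rwa [sineMap_one_sub]) (by linarith)
    rw [sineMap_one_sub] at this
    linarith
  have hpi := Real.pi_gt_three
  -- For x ≤ 1/4 the factor is (1 + 1/2)(1 - 1/4) = 9/8. For x ≥ 1/4 it comes from πx(1-x) ≥ 3 ·
  -- 3/16 and 1 + s ≥ 2s.
  rcases le_total x (1 / 4) with h4 | h4
  · have h1 := sineMap_le_pi_mul hx.1
    have h3 : 9 / 8 ≤ (1 + sineMap x) * (1 - x) := by nlinarith [hx.1]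
    nlinarith [mul_le_mul_of_nonneg_left h3 (mul_nonneg Real.pi_pos.le hx.1)]
  · have h1 : sineMap x ≤ 1 := Real.sin_le_one _
    have h2 : 3 / 16 ≤ x * (1 - x) := by nlinarith
    have h3 : 9 / 16 ≤ Real.pi * (x * (1 - x)) := by nlinarith
    nlinarith

/-- In the metric `|dx| / √(x(1-x))` the quadratic map expands by the factor `2`. -/
theorem quadMap_deriv_sq_mul (x : ℝ) :
    (4 - 8 * x) ^ 2 * (x * (1 - x)) = 4 * (quadMap x * (1 - quadMap x)) := by
  unfold quadMap
  ring

theorem sineMap_deriv_sq (x : ℝ) :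
    (Real.pi * Real.cos (Real.pi * x)) ^ 2 =
      Real.pi ^ 2 * ((1 - sineMap x) * (1 + sineMap x)) := by
  have := Real.sin_sq_add_cos_sq (Real.pi * x)
  rw [mul_pow, sineMap]
  congr 1
  linarith

/-- In the metric `|dx| / √(x(1-x))` the sine map expands by a factor at least `√π`. -/
theorem le_sineMap_deriv_sq_mul {x : ℝ} (hx : x ∈ Icc (0 : ℝ) 1) :
    Real.pi * (sineMap x * (1 - sineMap x)) ≤
      (Real.pi * Real.cos (Real.pi * x)) ^ 2 * (x * (1 - x)) := by
  have h1 : 0 ≤ 1 - sineMap x := sub_nonneg.2 (Real.sin_le_one _)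
  have := mul_le_mul_of_nonneg_left (sineMap_le_mul_one_add hx) (mul_nonneg Real.pi_pos.le h1)
  rw [sineMap_deriv_sq]
  linarith

theorem le_sineMap_deriv_sq_mul_of_half_le {x : ℝ} (hx : x ∈ Icc (0 : ℝ) 1)
    (hs : 1 / 2 ≤ sineMap x) :
    9 / 8 * Real.pi * (sineMap x * (1 - sineMap x)) ≤
      (Real.pi * Real.cos (Real.pi * x)) ^ 2 * (x * (1 - x)) := by
  have h1 : 0 ≤ 1 - sineMap x := sub_nonneg.2 (Real.sin_le_one _)
  have := mul_le_mul_of_nonneg_left (sineMap_le_mul_one_add_of_half_le hx hs)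
    (mul_nonneg Real.pi_pos.le h1)
  rw [sineMap_deriv_sq]
  linarith

/-! ### Derivatives of iterates and absence of neutral cycles -/

section Iterates

variable {f f' : ℝ → ℝ}

/-- The chain rule for iterates. -/
theorem hasDerivAt_iterate_prod (hf : ∀ x, HasDerivAt f (f' x) x) (n : ℕ) (x : ℝ) :
    HasDerivAt f^[n] (∏ i ∈ Finset.range n, f' (f^[i] x)) x := by
  induction n with
  | zero => simpa using hasDerivAt_id x
  | succ n ih =>
    rw [Function.iterate_succ', Finset.prod_range_succ, mul_comm]
    exact (hf _).comp x ih

theorem derivWithin_iterate_eq_prod (hf : ∀ x, HasDerivAt f (f' x) x) (n : ℕ) {x : ℝ}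
    (hx : x ∈ Icc (0 : ℝ) 1) :
    derivWithin f^[n] (Icc 0 1) x = ∏ i ∈ Finset.range n, f' (f^[i] x) :=
  (hasDerivAt_iterate_prod hf n x).hasDerivWithinAt.derivWithin
    (uniqueDiffOn_Icc zero_lt_one x hx)

/-- A lower bound for the derivative of the iterates in the metric `|dx| / √(x(1-x))` is
multiplicative along orbits. -/
theorem le_sq_prod_mul_of_expanding {c : ℝ} {x C : ℝ} {a : ℕ} (hc : 0 ≤ c) (hC : 0 ≤ C)
    (b : ℕ)
    (ha : C * (f^[a] x * (1 - f^[a] x)) ≤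
      (∏ i ∈ Finset.range a, f' (f^[i] x)) ^ 2 * (x * (1 - x)))
    (h : ∀ i, a ≤ i → i < a + b → c * (f (f^[i] x) * (1 - f (f^[i] x))) ≤
      f' (f^[i] x) ^ 2 * (f^[i] x * (1 - f^[i] x))) :
    C * c ^ b * (f^[a + b] x * (1 - f^[a + b] x)) ≤
      (∏ i ∈ Finset.range (a + b), f' (f^[i] x)) ^ 2 * (x * (1 - x)) := by
  induction b with
  | zero => simpa using ha
  | succ b ih =>
    have ih := ih fun i h1 h2 => h i h1 (by omega)
    have h1 := h (a + b) (by omega) (by omega)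
    rw [← add_assoc, Finset.prod_range_succ, Function.iterate_succ_apply']
    have h2 := mul_le_mul_of_nonneg_left h1 (mul_nonneg hC (pow_nonneg hc b))
    have h3 := mul_le_mul_of_nonneg_left ih (sq_nonneg (f' (f^[a + b] x)))
    rw [pow_succ, mul_pow]
    linarith

theorem pow_le_sq_prod_mul_of_expanding {c : ℝ} {x : ℝ} (hc : 0 ≤ c) (n : ℕ)
    (h : ∀ i < n, c * (f (f^[i] x) * (1 - f (f^[i] x))) ≤
      f' (f^[i] x) ^ 2 * (f^[i] x * (1 - f^[i] x))) :
    c ^ n * (f^[n] x * (1 - f^[n] x)) ≤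
      (∏ i ∈ Finset.range n, f' (f^[i] x)) ^ 2 * (x * (1 - x)) := by
  simpa using le_sq_prod_mul_of_expanding (f' := f') (a := 0) hc zero_le_one n (by simp)
    fun i _ h2 => h i (by simpa using h2)

/-- A map which expands the metric `|dx| / √(x(1-x))` has no neutral periodic orbits. -/
theorem not_isAsymptoticToNeutral_of_expanding {c : ℝ} (hc : 1 < c)
    (hf : ∀ x, HasDerivAt f (f' x) x) (hI : MapsTo f (Icc 0 1) (Icc 0 1))
    (h0 : f 0 = 0) (h1 : f 1 = 0) (h0' : 1 < f' 0)
    (h : ∀ x ∈ Icc (0 : ℝ) 1, c * (f x * (1 - f x)) ≤ f' x ^ 2 * (x * (1 - x))) (x : ℝ) :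
    ¬ IsAsymptoticToNeutral f (Icc 0 1) x := by
  rintro ⟨q, hq, p, hp, hper, hD, -⟩
  rw [derivWithin_iterate_eq_prod hf p hq] at hD
  have hfix : ∀ i, f^[i] 0 = 0 := fun i => Function.iterate_fixed h0 i
  rcases hq.1.eq_or_lt with rfl | hq0
  · simp only [hfix, Finset.prod_const, Finset.card_range, abs_pow] at hD
    exact (one_lt_pow₀ (h0'.trans_le (le_abs_self _)) hp.ne').ne' hD
  rcases hq.2.eq_or_lt with rfl | hq1
  · obtain ⟨p, rfl⟩ := Nat.exists_eq_succ_of_ne_zero hp.ne'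
    have : f^[p + 1] 1 = 1 := hper
    rw [Function.iterate_succ_apply, h1, hfix] at this
    exact zero_ne_one this
  have hw : 0 < q * (1 - q) := mul_pos hq0 (sub_pos.2 hq1)
  have key := pow_le_sq_prod_mul_of_expanding (f' := f') (by linarith) p
    fun i _ => h (f^[i] q) (hI.iterate i hq)
  rw [hper.eq, ← sq_abs (∏ i ∈ Finset.range p, f' (f^[i] q)), hD, one_pow] at key
  exact absurd (le_of_mul_le_mul_right key hw) (not_le.2 (one_lt_pow₀ hc hp.ne'))

end Iterates

theorem not_isAsymptoticToNeutral_quadMap (x : ℝ) :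
    ¬ IsAsymptoticToNeutral quadMap (Icc 0 1) x :=
  not_isAsymptoticToNeutral_of_expanding (c := 4) (by norm_num) hasDerivAt_quadMap
    isUnimodal_quadMap.mapsTo (by simp [quadMap]) (by simp [quadMap]) (by norm_num)
    (fun x _ => (quadMap_deriv_sq_mul x).ge) x

theorem not_isAsymptoticToNeutral_sineMap (x : ℝ) :
    ¬ IsAsymptoticToNeutral sineMap (Icc 0 1) x :=
  not_isAsymptoticToNeutral_of_expanding (c := Real.pi) (by linarith [Real.pi_gt_three])
    hasDerivAt_sineMap mapsTo_sineMap (by simp [sineMap]) (by simp [sineMap])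
    (by simpa using by linarith [Real.pi_gt_three])
    (fun x hx => le_sineMap_deriv_sq_mul hx) x

/-! ### Conjugacy of expanding tents -/

/-- Continuous self-maps of the unit interval with `F 0 = F 1 = 0` and `F (1/2) = 1` whose
restrictions to both halves of the interval expand distances by the factor `K⁻¹`. -/
structure IsExpandingTent (K : ℝ≥0) (F : Icc (0 : ℝ) 1 → Icc (0 : ℝ) 1) : Prop where
  continuous : Continuous F
  map_zero : F 0 = 0
  map_one : F 1 = 0
  map_half : ∀ x : Icc (0 : ℝ) 1, (x : ℝ) = 1 / 2 → F x = 1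
  dist_le_left : ∀ x y : Icc (0 : ℝ) 1, (x : ℝ) ≤ 1 / 2 → (y : ℝ) ≤ 1 / 2 →
    dist x y ≤ K * dist (F x) (F y)
  dist_le_right : ∀ x y : Icc (0 : ℝ) 1, 1 / 2 ≤ (x : ℝ) → 1 / 2 ≤ (y : ℝ) →
    dist x y ≤ K * dist (F x) (F y)

/-- Semiconjugacies preserving both halves of the unit interval. -/
structure IsSideSemiconj (F G h : Icc (0 : ℝ) 1 → Icc (0 : ℝ) 1) : Prop where
  semiconj : Function.Semiconj h F G
  left : ∀ x : Icc (0 : ℝ) 1, (x : ℝ) ≤ 1 / 2 → (h x : ℝ) ≤ 1 / 2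
  right : ∀ x : Icc (0 : ℝ) 1, 1 / 2 ≤ (x : ℝ) → 1 / 2 ≤ (h x : ℝ)

theorem IsSideSemiconj.id (F : Icc (0 : ℝ) 1 → Icc (0 : ℝ) 1) : IsSideSemiconj F F id :=
  ⟨Function.Semiconj.id_left, fun _ h => h, fun _ h => h⟩

theorem IsSideSemiconj.comp {F G E h k : Icc (0 : ℝ) 1 → Icc (0 : ℝ) 1}
    (hk : IsSideSemiconj G E k) (hh : IsSideSemiconj F G h) : IsSideSemiconj F E (k ∘ h) :=
  ⟨hk.semiconj.comp_left hh.semiconj, fun x hx => hk.left _ (hh.left x hx),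
    fun x hx => hk.right _ (hh.right x hx)⟩

namespace IsExpandingTent

variable {K : ℝ≥0} {F G : Icc (0 : ℝ) 1 → Icc (0 : ℝ) 1}

theorem exists_left (hG : IsExpandingTent K G) (y : Icc (0 : ℝ) 1) :
    ∃ x : Icc (0 : ℝ) 1, (x : ℝ) ≤ 1 / 2 ∧ G x = y := by
  have hc : Continuous fun t : ℝ => (G (projIcc 0 1 zero_le_one t) : ℝ) :=
    continuous_subtype_val.comp (hG.continuous.comp continuous_projIcc)
  have h := intermediate_value_Icc (by norm_num : (0 : ℝ) ≤ 1 / 2) hc.continuousOn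
  have h0 : G (projIcc 0 1 zero_le_one (0 : ℝ)) = 0 := by
    rw [projIcc_left]
    exact hG.map_zero
  have h1 : G (projIcc 0 1 zero_le_one (1 / 2 : ℝ)) = 1 :=
    hG.map_half _ (by rw [projIcc_of_mem _ (by norm_num : (1 / 2 : ℝ) ∈ Icc (0 : ℝ) 1)])
  simp only [h0, h1] at h
  obtain ⟨t, ht, hty⟩ := h y.2
  have ht' : t ∈ Icc (0 : ℝ) 1 := ⟨ht.1, ht.2.trans (by norm_num)⟩
  refine ⟨⟨t, ht'⟩, ht.2, Subtype.ext ?_⟩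
  simpa only [projIcc_of_mem _ ht'] using hty

theorem exists_right (hG : IsExpandingTent K G) (y : Icc (0 : ℝ) 1) :
    ∃ x : Icc (0 : ℝ) 1, 1 / 2 ≤ (x : ℝ) ∧ G x = y := by
  have hc : Continuous fun t : ℝ => (G (projIcc 0 1 zero_le_one t) : ℝ) :=
    continuous_subtype_val.comp (hG.continuous.comp continuous_projIcc)
  have h := intermediate_value_Icc' (by norm_num : (1 / 2 : ℝ) ≤ 1) hc.continuousOn
  have h0 : G (projIcc 0 1 zero_le_one (1 : ℝ)) = 0 := by
    rw [projIcc_right]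
    exact hG.map_one
  have h1 : G (projIcc 0 1 zero_le_one (1 / 2 : ℝ)) = 1 :=
    hG.map_half _ (by rw [projIcc_of_mem _ (by norm_num : (1 / 2 : ℝ) ∈ Icc (0 : ℝ) 1)])
  simp only [h0, h1] at h
  obtain ⟨t, ht, hty⟩ := h y.2
  have ht' : t ∈ Icc (0 : ℝ) 1 := ⟨le_trans (by norm_num) ht.1, ht.2⟩
  refine ⟨⟨t, ht'⟩, ht.1, Subtype.ext ?_⟩
  simpa only [projIcc_of_mem _ ht'] using hty

/-- At x the two semiconjugacies lie in the same half, where `G` expands, so their distance is at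
most `K` times their distance at `F x`. Iterating forces it to be 0. -/
theorem semiconj_unique (hK : K < 1) (hG : IsExpandingTent K G)
    {h k : Icc (0 : ℝ) 1 → Icc (0 : ℝ) 1} (hh : IsSideSemiconj F G h)
    (hk : IsSideSemiconj F G k) : h = k := by
  have step : ∀ x, dist (h x) (k x) ≤ K * dist (h (F x)) (k (F x)) := by
    intro x
    rw [hh.semiconj x, hk.semiconj x]
    rcases le_total (x : ℝ) (1 / 2) with hx | hx
    · exact hG.dist_le_left _ _ (hh.left x hx) (hk.left x hx)
    · exact hG.dist_le_right _ _ (hh.right x hx) (hk.right x hx)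
  have bound : ∀ (n : ℕ) (x), dist (h x) (k x) ≤ (K : ℝ) ^ n := by
    intro n
    induction n with
    | zero =>
      intro x
      rw [pow_zero, Subtype.dist_eq]
      exact Real.dist_le_of_mem_Icc_01 (h x).2 (k x).2
    | succ n ih =>
      intro x
      rw [pow_succ']
      exact (step x).trans (mul_le_mul_of_nonneg_left (ih _) K.coe_nonneg)
  funext x
  refine dist_le_zero.1 (ge_of_tendsto' (tendsto_pow_atTop_nhds_zero_of_lt_one K.coe_nonneg ?_)
    fun n => bound n x)
  exact_mod_cast hK

/-- The semiconjugacy is the fixed point of the contraction `h ↦ G⁻¹ ∘ h ∘ F`, where the inverse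
branch of `G` is chosen according to the half of the interval. -/
theorem exists_semiconj (hK : K < 1) (hF : IsExpandingTent K F) (hG : IsExpandingTent K G) :
    ∃ h, Continuous h ∧ IsSideSemiconj F G h := by
  choose L hL hGL using hG.exists_left
  choose R hR hGR using hG.exists_right
  have hLlip : LipschitzWith K L := LipschitzWith.of_dist_le_mul fun a b => by
    simpa only [hGL] using hG.dist_le_left _ _ (hL a) (hL b)
  have hRlip : LipschitzWith K R := LipschitzWith.of_dist_le_mul fun a b => by
    simpa only [hGR] using hG.dist_le_right _ _ (hR a) (hR b)
  have hL0 : L 0 = 0 := by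
    have := hG.dist_le_left (L 0) 0 (hL 0) (by norm_num)
    rw [hGL, hG.map_zero, dist_self, mul_zero] at this
    exact dist_le_zero.1 this
  have hR0 : R 0 = 1 := by
    have := hG.dist_le_right (R 0) 1 (hR 0) (by norm_num)
    rw [hGR, hG.map_one, dist_self, mul_zero] at this
    exact dist_le_zero.1 this
  have hLR : L 1 = R 1 := by
    let c : Icc (0 : ℝ) 1 := ⟨1 / 2, by norm_num⟩
    have hc : G c = 1 := hG.map_half c rfl
    have h1 := hG.dist_le_left (L 1) c (hL 1) le_rfl
    have h2 := hG.dist_le_right (R 1) c (hR 1) le_rfl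
    rw [hGL, hc, dist_self, mul_zero] at h1
    rw [hGR, hc, dist_self, mul_zero] at h2
    rw [dist_le_zero.1 h1, dist_le_zero.1 h2]
  -- The endpoint conditions are what makes the two branches agree at 1/2: there `F x = 1`, and `L 1
  -- = R 1`.
  let S : Set C(Icc (0 : ℝ) 1, Icc (0 : ℝ) 1) := {h | h 0 = 0 ∧ h 1 = 1}
  have hS : IsClosed S :=
    (isClosed_eq (continuous_eval_const _) continuous_const).inter
      (isClosed_eq (continuous_eval_const _) continuous_const)
  have : CompleteSpace S := hS.completeSpace_coe
  have : Nonempty S := ⟨⟨ContinuousMap.id _, rfl, rfl⟩⟩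
  let Φ : S → S := fun h =>
    ⟨⟨fun x => if (x : ℝ) ≤ 1 / 2 then L (h.1 (F x)) else R (h.1 (F x)),
      Continuous.if_le (hLlip.continuous.comp (h.1.continuous.comp hF.continuous))
        (hRlip.continuous.comp (h.1.continuous.comp hF.continuous))
        continuous_subtype_val continuous_const
        fun x hx => by
          rw [hF.map_half x hx, h.2.2, hLR]⟩,
      by simp [hF.map_zero, h.2.1, hL0],
      by
        have : ¬ (1 : ℝ) ≤ 2⁻¹ := by norm_num
        simp [hF.map_one, h.2.1, hR0, this]⟩
  have hΦ : ∀ h x, (Φ h).1 x = if (x : ℝ) ≤ 1 / 2 then L (h.1 (F x)) else R (h.1 (F x)) :=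
    fun _ _ => rfl
  have hcontr : ContractingWith K Φ := by
    refine ⟨hK, LipschitzWith.of_dist_le_mul fun h k => ?_⟩
    rw [Subtype.dist_eq, Subtype.dist_eq]
    refine (ContinuousMap.dist_le (mul_nonneg K.coe_nonneg dist_nonneg)).2 fun x => ?_
    have hx : K * dist (h.1 (F x)) (k.1 (F x)) ≤ K * dist h.1 k.1 :=
      mul_le_mul_of_nonneg_left (ContinuousMap.dist_apply_le_dist _) K.coe_nonneg
    rw [hΦ, hΦ]
    split_ifs
    · exact (hLlip.dist_le_mul _ _).trans hx
    · exact (hRlip.dist_le_mul _ _).trans hx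
  obtain ⟨h, hh⟩ : ∃ h, Φ h = h := ⟨_, hcontr.fixedPoint_isFixedPt⟩
  have hfix : ∀ x, h.1 x = if (x : ℝ) ≤ 1 / 2 then L (h.1 (F x)) else R (h.1 (F x)) :=
    fun x => by rw [← hΦ, hh]
  refine ⟨h.1, h.1.continuous, fun x => ?_, fun x hx => ?_, fun x hx => ?_⟩
  · rw [hfix x]
    split_ifs
    · rw [hGL]
    · rw [hGR]
  · rw [hfix x, if_pos hx]
    exact hL _
  · rcases hx.eq_or_lt with hx | hx
    · rw [hfix x, if_pos hx.ge, hF.map_half x hx.symm, h.2.2, hLR]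
      exact hR _
    · rw [hfix x, if_neg hx.not_ge]
      exact hR _

/-- Semiconjugacies exist in both directions; uniqueness identifies their composites with the
identity. -/
theorem exists_homeomorph (hK : K < 1) (hF : IsExpandingTent K F) (hG : IsExpandingTent K G) :
    ∃ h : Icc (0 : ℝ) 1 ≃ₜ Icc (0 : ℝ) 1, IsSideSemiconj F G h := by
  obtain ⟨h, hc, hh⟩ := exists_semiconj hK hF hG
  obtain ⟨k, kc, hk⟩ := exists_semiconj hK hG hF
  have h1 : k ∘ h = id := semiconj_unique hK hF (hk.comp hh) (.id F)
  have h2 : h ∘ k = id := semiconj_unique hK hG (hh.comp hk) (.id G)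
  exact ⟨⟨⟨h, k, congrFun h1, congrFun h2⟩, hc, kc⟩, hh⟩

end IsExpandingTent

/-! ### The arcsine chart and the conjugacy of the two maps -/

theorem arcsin_sqrt_one_sub {x : ℝ} (hx : x ∈ Icc (0 : ℝ) 1) :
    Real.arcsin √(1 - x) = Real.pi / 2 - Real.arcsin √x := by
  rw [Real.arcsin_eq_arccos (Real.sqrt_nonneg _), Real.sq_sqrt (sub_nonneg.2 hx.2),
    sub_sub_cancel, Real.arccos]

theorem hasDerivAt_arcsin_sqrt {x : ℝ} (hx : x ∈ Ioo (0 : ℝ) 1) :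
    HasDerivAt (fun x => Real.arcsin √x) (1 / (2 * √(x * (1 - x)))) x := by
  have h0 : 0 < √x := Real.sqrt_pos.2 hx.1
  have h1 : √x < 1 := (Real.sqrt_lt' one_pos).2 (by simpa using hx.2)
  refine ((Real.hasDerivAt_arcsin (by linarith) h1.ne).comp x
    (Real.hasDerivAt_sqrt hx.1.ne')).congr_deriv ?_
  rw [Real.sq_sqrt hx.1.le, Real.sqrt_mul hx.1.le, div_mul_div_comm, one_mul]
  ring_nf

/-- The order isomorphism `x ↦ (2/π) arcsin √x` of the unit interval. -/
noncomputable def arcsineChart : Icc (0 : ℝ) 1 ≃ₜ Icc (0 : ℝ) 1 where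
  toFun x := ⟨2 / Real.pi * Real.arcsin √x, by
    have hpi := Real.pi_pos
    constructor
    · have := Real.arcsin_nonneg.2 (Real.sqrt_nonneg x)
      positivity
    · rw [div_mul_eq_mul_div, div_le_one hpi]
      linarith [Real.arcsin_le_pi_div_two √x]⟩
  invFun t := ⟨Real.sin (Real.pi / 2 * t) ^ 2, sq_nonneg _, Real.sin_sq_le_one _⟩
  left_inv x := by
    have hpi := Real.pi_pos.ne'
    apply Subtype.ext
    have : Real.pi / 2 * (2 / Real.pi * Real.arcsin √x) = Real.arcsin √x := by
      field_simp
    simp only [this]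
    rw [Real.sin_arcsin (by linarith [Real.sqrt_nonneg (x : ℝ)]) (Real.sqrt_le_one.2 x.2.2),
      Real.sq_sqrt x.2.1]
  right_inv t := by
    have hpi := Real.pi_pos
    have h0 := mul_nonneg hpi.le t.2.1
    have h1 := mul_le_mul_of_nonneg_left t.2.2 hpi.le
    apply Subtype.ext
    simp only
    rw [Real.sqrt_sq (Real.sin_nonneg_of_nonneg_of_le_pi (by linarith) (by linarith)),
      Real.arcsin_sin (by linarith) (by linarith)]
    field_simp
  continuous_toFun := by
    refine Continuous.subtype_mk ?_ _
    exact continuous_const.mul (Real.continuous_arcsin.comp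
      (Real.continuous_sqrt.comp continuous_subtype_val))
  continuous_invFun := by fun_prop

theorem coe_arcsineChart (x : Icc (0 : ℝ) 1) :
    (arcsineChart x : ℝ) = 2 / Real.pi * Real.arcsin √x := rfl

theorem dist_arcsineChart (x y : Icc (0 : ℝ) 1) :
    dist (arcsineChart x) (arcsineChart y) =
      2 / Real.pi * |Real.arcsin √x - Real.arcsin √y| := by
  rw [Subtype.dist_eq, coe_arcsineChart, coe_arcsineChart, Real.dist_eq, ← mul_sub, abs_mul,
    abs_of_pos (div_pos two_pos Real.pi_pos)]

theorem strictMono_arcsineChart : StrictMono arcsineChart := by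
  intro x y hxy
  refine Subtype.coe_lt_coe.1 (mul_lt_mul_of_pos_left ?_ (div_pos two_pos Real.pi_pos))
  refine Real.strictMonoOn_arcsin ⟨?_, Real.sqrt_le_one.2 x.2.2⟩ ⟨?_, Real.sqrt_le_one.2 y.2.2⟩
    (Real.sqrt_lt_sqrt x.2.1 hxy)
  all_goals linarith [Real.sqrt_nonneg (x : ℝ), Real.sqrt_nonneg (y : ℝ)]

theorem arcsineChart_half : arcsineChart ⟨1 / 2, by norm_num⟩ = ⟨1 / 2, by norm_num⟩ := by
  apply Subtype.ext
  have := arcsin_sqrt_one_sub (x := 1 / 2) (by norm_num)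
  rw [sub_half] at this
  rw [coe_arcsineChart, show Real.arcsin √(1 / 2) = Real.pi / 4 by linarith]
  have := Real.pi_pos
  field_simp
  norm_num

theorem arcsineChart_le_half {x : Icc (0 : ℝ) 1} :
    (arcsineChart x : ℝ) ≤ 1 / 2 ↔ (x : ℝ) ≤ 1 / 2 := by
  have := strictMono_arcsineChart.le_iff_le (a := x) (b := ⟨1 / 2, by norm_num⟩)
  rwa [arcsineChart_half] at this

theorem half_le_arcsineChart {x : Icc (0 : ℝ) 1} :
    1 / 2 ≤ (arcsineChart x : ℝ) ↔ 1 / 2 ≤ (x : ℝ) := by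
  have := strictMono_arcsineChart.le_iff_le (a := ⟨1 / 2, by norm_num⟩) (b := x)
  rwa [arcsineChart_half] at this

theorem arcsineChart_zero : arcsineChart 0 = 0 :=
  Subtype.ext (by simp [coe_arcsineChart])

theorem arcsineChart_one : arcsineChart 1 = 1 :=
  Subtype.ext (by simp [coe_arcsineChart])

section Chart

variable {f f' : ℝ → ℝ} {c : ℝ}

/-- The square root of the expansion hypothesis says that arcsin √f - √c arcsin √x has nonnegative
derivative. The chart is singular at 0 and 1, so only interior points are differentiated. -/
theorem sqrt_mul_arcsin_sqrt_sub_le (hf : ∀ x, HasDerivAt f (f' x) x) (h0 : f 0 = 0)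
    (h1 : f (1 / 2) = 1) (hmono : StrictMonoOn f (Icc 0 (1 / 2)))
    (hpos : ∀ x ∈ Icc (0 : ℝ) (1 / 2), 0 ≤ f' x)
    (h : ∀ x ∈ Icc (0 : ℝ) 1, c * (f x * (1 - f x)) ≤ f' x ^ 2 * (x * (1 - x)))
    {x y : ℝ} (hx : 0 ≤ x) (hxy : x ≤ y) (hy : y ≤ 1 / 2) :
    √c * (Real.arcsin √y - Real.arcsin √x) ≤ Real.arcsin √(f y) - Real.arcsin √(f x) := by
  have hfc : Continuous f := continuous_iff_continuousAt.2 fun x => (hf x).continuousAt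
  have key : MonotoneOn (fun x => Real.arcsin √(f x) - √c * Real.arcsin √x)
      (Icc 0 (1 / 2)) := by
    have hd : ∀ x ∈ Ioo (0 : ℝ) (1 / 2),
        HasDerivAt (fun x => Real.arcsin √(f x) - √c * Real.arcsin √x)
          (1 / (2 * √(f x * (1 - f x))) * f' x - √c * (1 / (2 * √(x * (1 - x))))) x := by
      intro x hx
      have hm : x ∈ Icc (0 : ℝ) (1 / 2) := ⟨hx.1.le, hx.2.le⟩
      have hfx : f x ∈ Ioo (0 : ℝ) 1 :=
        ⟨by simpa [h0] using hmono ⟨le_rfl, by norm_num⟩ hm hx.1,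
          by simpa only [h1] using hmono hm ⟨by norm_num, le_rfl⟩ hx.2⟩
      exact ((hasDerivAt_arcsin_sqrt hfx).comp x (hf x)).sub
        ((hasDerivAt_arcsin_sqrt ⟨hx.1, hx.2.trans (by norm_num)⟩).const_mul _)
    refine monotoneOn_of_deriv_nonneg (convex_Icc _ _) ?_ ?_ ?_
    · exact ((Real.continuous_arcsin.comp (Real.continuous_sqrt.comp hfc)).sub
        (continuous_const.mul (Real.continuous_arcsin.comp Real.continuous_sqrt))).continuousOn
    · rw [interior_Icc]
      exact fun x hx => (hd x hx).differentiableAt.differentiableWithinAt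
    · rw [interior_Icc]
      intro x hx
      have hm : x ∈ Icc (0 : ℝ) (1 / 2) := ⟨hx.1.le, hx.2.le⟩
      have hfx : f x ∈ Ioo (0 : ℝ) 1 :=
        ⟨by simpa [h0] using hmono ⟨le_rfl, by norm_num⟩ hm hx.1,
          by simpa only [h1] using hmono hm ⟨by norm_num, le_rfl⟩ hx.2⟩
      have hw : 0 < √(x * (1 - x)) :=
        Real.sqrt_pos.2 (mul_pos hx.1 (by linarith [hx.2]))
      have hwf : 0 < f x * (1 - f x) := mul_pos hfx.1 (sub_pos.2 hfx.2)
      have hwf' := Real.sqrt_pos.2 hwf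
      have hle := Real.sqrt_le_sqrt (h x ⟨hx.1.le, by linarith [hx.2]⟩)
      rw [Real.sqrt_mul' _ hwf.le, Real.sqrt_mul (sq_nonneg _), Real.sqrt_sq (hpos x hm)] at hle
      rw [(hd x hx).deriv, sub_nonneg, mul_one_div, one_div_mul_eq_div,
        div_le_div_iff₀ (by positivity) (by positivity)]
      linarith
  have := key ⟨hx, hxy.trans hy⟩ ⟨hx.trans hxy, hy⟩ hxy
  simp only at this
  linarith

/-- The right half reduces to the left one, since x ↦ 1 - x becomes the reflection t ↦ 1 - t in the
chart. -/
theorem isExpandingTent_of_expanding (hf : ∀ x, HasDerivAt f (f' x) x)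
    (hI : MapsTo f (Icc 0 1) (Icc 0 1)) (hsymm : ∀ x, f (1 - x) = f x) (h0 : f 0 = 0)
    (h1 : f (1 / 2) = 1) (hmono : StrictMonoOn f (Icc 0 (1 / 2)))
    (hpos : ∀ x ∈ Icc (0 : ℝ) (1 / 2), 0 ≤ f' x) (hc : 0 < c)
    (h : ∀ x ∈ Icc (0 : ℝ) 1, c * (f x * (1 - f x)) ≤ f' x ^ 2 * (x * (1 - x))) :
    IsExpandingTent (Real.toNNReal (√c)⁻¹)
      (arcsineChart ∘ hI.restrict f _ _ ∘ arcsineChart.symm) := by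
  have hc' : 0 < √c := Real.sqrt_pos.2 hc
  have hfc : Continuous f := continuous_iff_continuousAt.2 fun x => (hf x).continuousAt
  have left : ∀ x y : ℝ, 0 ≤ x → x ≤ 1 / 2 → 0 ≤ y → y ≤ 1 / 2 →
      |Real.arcsin √x - Real.arcsin √y| ≤
        (√c)⁻¹ * |Real.arcsin √(f x) - Real.arcsin √(f y)| := by
    intro x y hx0 hx1 hy0 hy1
    wlog hxy : x ≤ y generalizing x y
    · rw [abs_sub_comm, abs_sub_comm (Real.arcsin √(f x))]
      exact this y x hy0 hy1 hx0 hx1 (le_of_not_ge hxy)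
    rw [← div_eq_inv_mul, le_div_iff₀' hc', abs_sub_comm, abs_sub_comm (Real.arcsin √(f x)),
      abs_of_nonneg (sub_nonneg.2 (Real.monotone_arcsin (Real.sqrt_le_sqrt hxy)))]
    exact (sqrt_mul_arcsin_sqrt_sub_le hf h0 h1 hmono hpos h hx0 hxy hy1).trans (le_abs_self _)
  have hdist : ∀ s t : Icc (0 : ℝ) 1,
      |Real.arcsin √(arcsineChart.symm s : ℝ) - Real.arcsin √(arcsineChart.symm t : ℝ)| ≤
        (√c)⁻¹ * |Real.arcsin √(f (arcsineChart.symm s)) -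
          Real.arcsin √(f (arcsineChart.symm t))| →
      dist s t ≤ (Real.toNNReal (√c)⁻¹ : ℝ) *
        dist ((arcsineChart ∘ hI.restrict f _ _ ∘ arcsineChart.symm) s)
          ((arcsineChart ∘ hI.restrict f _ _ ∘ arcsineChart.symm) t) := by
    intro s t hst
    rw [Real.coe_toNNReal _ (inv_nonneg.2 hc'.le), Function.comp_apply, Function.comp_apply,
      Function.comp_apply, Function.comp_apply, dist_arcsineChart, mul_left_comm]
    conv_lhs => rw [← arcsineChart.apply_symm_apply s, ← arcsineChart.apply_symm_apply t,
      dist_arcsineChart]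
    exact mul_le_mul_of_nonneg_left hst (div_pos two_pos Real.pi_pos).le
  have hle : ∀ t : Icc (0 : ℝ) 1, (t : ℝ) ≤ 1 / 2 → (arcsineChart.symm t : ℝ) ≤ 1 / 2 :=
    fun t ht => arcsineChart_le_half.1 (by rwa [arcsineChart.apply_symm_apply])
  have hge : ∀ t : Icc (0 : ℝ) 1, 1 / 2 ≤ (t : ℝ) → 1 / 2 ≤ (arcsineChart.symm t : ℝ) :=
    fun t ht => half_le_arcsineChart.1 (by rwa [arcsineChart.apply_symm_apply])
  have hs0 : arcsineChart.symm 0 = 0 := by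
    rw [Homeomorph.symm_apply_eq, arcsineChart_zero]
  have hs1 : arcsineChart.symm 1 = 1 := by
    rw [Homeomorph.symm_apply_eq, arcsineChart_one]
  have hf1 : f 1 = 0 := by
    rw [← hsymm, sub_self, h0]
  refine ⟨?_, ?_, ?_, ?_, ?_, ?_⟩
  · exact arcsineChart.continuous.comp ((hfc.continuousOn.mapsToRestrict hI).comp
      arcsineChart.symm.continuous)
  · rw [Function.comp_apply, Function.comp_apply, hs0,
      show hI.restrict f _ _ 0 = 0 from Subtype.ext h0, arcsineChart_zero]
  · rw [Function.comp_apply, Function.comp_apply, hs1,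
      show hI.restrict f _ _ 1 = 0 from Subtype.ext hf1, arcsineChart_zero]
  · intro (t : Icc (0 : ℝ) 1) ht
    have : (arcsineChart.symm t : ℝ) = 1 / 2 := le_antisymm (hle t ht.le) (hge t ht.ge)
    have h1' : hI.restrict f _ _ (arcsineChart.symm t) = 1 :=
      Subtype.ext (by rw [MapsTo.val_restrict_apply, this, h1]; rfl)
    rw [Function.comp_apply, Function.comp_apply, h1', arcsineChart_one]
  · intro s t hs ht
    exact hdist s t (left _ _ (arcsineChart.symm s).2.1 (hle s hs) (arcsineChart.symm t).2.1
      (hle t ht))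
  · intro s t hs ht
    refine hdist s t ?_
    have := left (1 - arcsineChart.symm s) (1 - arcsineChart.symm t)
      (sub_nonneg.2 (arcsineChart.symm s).2.2) (by linarith [hge s hs])
      (sub_nonneg.2 (arcsineChart.symm t).2.2) (by linarith [hge t ht])
    rwa [hsymm, hsymm, arcsin_sqrt_one_sub (arcsineChart.symm s).2,
      arcsin_sqrt_one_sub (arcsineChart.symm t).2, sub_sub_sub_cancel_left, abs_sub_comm] at this

end Chart

theorem exists_isTopConjugacy_quadMap_sineMap :
    ∃ h : Icc (0 : ℝ) 1 ≃ₜ Icc (0 : ℝ) 1, IsTopConjugacy quadMap sineMap h ∧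
      (∀ x : Icc (0 : ℝ) 1, (x : ℝ) ≤ 1 / 2 → (h x : ℝ) ≤ 1 / 2) ∧
      (∀ x : Icc (0 : ℝ) 1, 1 / 2 ≤ (x : ℝ) → 1 / 2 ≤ (h x : ℝ)) := by
  have hpi := Real.pi_gt_three
  -- Both tents need the same contraction constant; 3 lies below both 4 and π.
  have hquad := isExpandingTent_of_expanding (c := 3) hasDerivAt_quadMap
    isUnimodal_quadMap.mapsTo (fun x => by unfold quadMap; ring) (by simp [quadMap])
    (by norm_num [quadMap])
    (by
      rintro x ⟨hx0, hx1⟩ y ⟨hy0, hy1⟩ hxy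
      simp only [quadMap]
      nlinarith)
    (fun x hx => by linarith [hx.2]) (by norm_num)
    (fun x hx => by
      have := isUnimodal_quadMap.mapsTo hx
      rw [quadMap_deriv_sq_mul]
      exact mul_le_mul_of_nonneg_right (by norm_num) (mul_nonneg this.1 (sub_nonneg.2 this.2)))
  have hsine := isExpandingTent_of_expanding (c := 3) hasDerivAt_sineMap mapsTo_sineMap
    sineMap_one_sub (by simp [sineMap]) sineMap_half strictMonoOn_sineMap
    (fun x hx => mul_nonneg Real.pi_pos.le (Real.cos_nonneg_of_neg_pi_div_two_le_of_le
      (by nlinarith [hx.1]) (by nlinarith [hx.2]))) (by norm_num)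
    (fun x hx => by
      have := mapsTo_sineMap hx
      exact (mul_le_mul_of_nonneg_right hpi.le
        (mul_nonneg this.1 (sub_nonneg.2 this.2))).trans (le_sineMap_deriv_sq_mul hx))
  have hK : Real.toNNReal (√3)⁻¹ < 1 := by
    rw [Real.toNNReal_lt_one]
    exact inv_lt_one_of_one_lt₀ (Real.lt_sqrt_of_sq_lt (by norm_num))
  obtain ⟨k, hk⟩ := hquad.exists_homeomorph hK hsine
  refine ⟨(arcsineChart.trans k).trans arcsineChart.symm,
    ⟨isUnimodal_quadMap.mapsTo, mapsTo_sineMap, ?_⟩, fun x hx => ?_, fun x hx => ?_⟩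
  · funext x
    have := hk.semiconj (arcsineChart x)
    simp only [Function.comp_apply, Homeomorph.symm_apply_apply] at this
    simp only [Function.comp_apply, Homeomorph.trans_apply, this, Homeomorph.symm_apply_apply]
  · rw [← arcsineChart_le_half]
    simp only [Homeomorph.trans_apply, Homeomorph.apply_symm_apply]
    exact hk.left _ (arcsineChart_le_half.2 hx)
  · rw [← half_le_arcsineChart]
    simp only [Homeomorph.trans_apply, Homeomorph.apply_symm_apply]
    exact hk.right _ (half_le_arcsineChart.2 hx)

/-! ### Criteria for the sign of the exponent, and itineraries -/

theorem log_ofReal_exp (t : ℝ) : ENNReal.log (ENNReal.ofReal (Real.exp t)) = (t : EReal) := by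
  rw [ENNReal.log_ofReal_of_pos (Real.exp_pos t), Real.log_exp]

theorem lowerLyapunov_neg_of_frequently {f : ℝ → ℝ} {I : Set ℝ} {x c : ℝ} (hc : 0 < c)
    (h : ∃ᶠ n : ℕ in atTop, |derivWithin f^[n] I x| ≤ Real.exp (-c * n)) :
    lowerLyapunov f I x < 0 := by
  refine lt_of_le_of_lt (b := ((-c : ℝ) : EReal)) ?_ (by exact_mod_cast neg_lt_zero.2 hc)
  refine liminf_le_of_frequently_le' ((h.and_eventually (eventually_gt_atTop 0)).mono ?_)
  rintro n ⟨hn, hn0⟩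
  rw [EReal.div_le_iff_le_mul (by exact_mod_cast hn0) (by exact_mod_cast EReal.coe_ne_top n)]
  refine (ENNReal.log_monotone (ENNReal.ofReal_le_ofReal hn)).trans_eq ?_
  rw [log_ofReal_exp]
  push_cast
  exact mul_comm _ _

theorem lowerLyapunov_pos_of_eventually {f : ℝ → ℝ} {I : Set ℝ} {x c : ℝ} (hc : 0 < c)
    (h : ∀ᶠ n : ℕ in atTop, Real.exp (c * n) ≤ |derivWithin f^[n] I x|) :
    0 < lowerLyapunov f I x := by
  refine lt_of_lt_of_le (b := (c : EReal)) (by exact_mod_cast hc) ?_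
  refine le_liminf_of_le (by isBoundedDefault) ((h.and (eventually_gt_atTop 0)).mono ?_)
  rintro n ⟨hn, hn0⟩
  rw [EReal.le_div_iff_mul_le (by exact_mod_cast hn0) (by exact_mod_cast EReal.coe_ne_top n)]
  refine Eq.trans_le ?_ (ENNReal.log_monotone (ENNReal.ofReal_le_ofReal hn))
  rw [log_ofReal_exp]
  push_cast
  ring_nf

/-- The orbit of `x` under `f` visits the left half of the unit interval at the times satisfying
`P`, and the right half at all other times. -/
def HasItinerary (f : ℝ → ℝ) (P : ℕ → Prop) (x : ℝ) : Prop :=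
  ∀ n, (P n → f^[n] x ≤ 1 / 2) ∧ (¬ P n → 1 / 2 ≤ f^[n] x)

theorem exists_quadMap_eq {y : ℝ} (hy : y ∈ Icc (0 : ℝ) 1) (p : Prop) :
    ∃ x ∈ Icc (0 : ℝ) 1, quadMap x = y ∧ (p → x ≤ 1 / 2) ∧ (¬ p → 1 / 2 ≤ x) := by
  have h0 := Real.sqrt_nonneg (1 - y)
  have h1 : √(1 - y) ≤ 1 := Real.sqrt_le_one.2 (by linarith [hy.1])
  have h2 := Real.sq_sqrt (sub_nonneg.2 hy.2)
  by_cases hp : p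
  · refine ⟨(1 - √(1 - y)) / 2, ⟨by linarith, by linarith⟩, ?_, fun _ => by linarith,
      fun h => absurd hp h⟩
    unfold quadMap
    linarith
  · refine ⟨(1 + √(1 - y)) / 2, ⟨by linarith, by linarith⟩, ?_, fun h => absurd h hp,
      fun _ => by linarith⟩
    unfold quadMap
    linarith

/-- Finite itineraries are realized by inverse branches. Both halves contain 1/2, so the conditions
are closed and compactness gives the infinite case. -/
theorem exists_hasItinerary_quadMap (P : ℕ → Prop) :
    ∃ x ∈ Icc (0 : ℝ) 1, HasItinerary quadMap P x := by
  have fin : ∀ (n : ℕ) (P : ℕ → Prop), ∃ x ∈ Icc (0 : ℝ) 1, ∀ i < n,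
      (P i → quadMap^[i] x ≤ 1 / 2) ∧ (¬ P i → 1 / 2 ≤ quadMap^[i] x) := by
    intro n
    induction n with
    | zero => exact fun P => ⟨0, by norm_num, by simp⟩
    | succ n ih =>
      intro P
      obtain ⟨y, hy, hyP⟩ := ih fun i => P (i + 1)
      obtain ⟨x, hx, rfl, hxP⟩ := exists_quadMap_eq hy (P 0)
      refine ⟨x, hx, fun i hi => ?_⟩
      cases i with
      | zero => exact hxP
      | succ i => exact hyP i (by omega)
  let S : ℕ → Set ℝ := fun n => Icc 0 1 ∩ ⋂ i < n,
    {x | (P i → quadMap^[i] x ≤ 1 / 2) ∧ (¬ P i → 1 / 2 ≤ quadMap^[i] x)}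
  have hcont : ∀ i, Continuous quadMap^[i] := fun i =>
    Continuous.iterate (by unfold quadMap; fun_prop) i
  have hclosed : ∀ n, IsClosed (S n) := by
    intro n
    refine isClosed_Icc.inter (isClosed_biInter fun i _ => ?_)
    by_cases hp : P i
    · simpa [hp] using isClosed_le (hcont i) continuous_const
    · simpa [hp] using isClosed_le continuous_const (hcont i)
  obtain ⟨x, hx⟩ := IsCompact.nonempty_iInter_of_sequence_nonempty_isCompact_isClosed S
    (fun n => inter_subset_inter_right _ (biInter_mono (fun i hi => Nat.lt_succ_of_lt hi)
      fun _ _ => subset_rfl))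
    (fun n => by
      obtain ⟨x, hx, hxP⟩ := fin n P
      exact ⟨x, hx, mem_iInter₂.2 hxP⟩)
    (isCompact_Icc.inter_right (isClosed_biInter fun i hi => absurd hi (Nat.not_lt_zero i)))
    hclosed
  rw [mem_iInter] at hx
  exact ⟨x, (hx 0).1, fun n => mem_iInter₂.1 (hx (n + 1)).2 n n.lt_succ_self⟩

theorem HasItinerary.of_isTopConjugacy {f g : ℝ → ℝ} {P : ℕ → Prop}
    {h : Icc (0 : ℝ) 1 ≃ₜ Icc (0 : ℝ) 1} (hfg : IsTopConjugacy f g h)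
    (hl : ∀ x : Icc (0 : ℝ) 1, (x : ℝ) ≤ 1 / 2 → (h x : ℝ) ≤ 1 / 2)
    (hr : ∀ x : Icc (0 : ℝ) 1, 1 / 2 ≤ (x : ℝ) → 1 / 2 ≤ (h x : ℝ)) {y : Icc (0 : ℝ) 1}
    (hy : HasItinerary f P y) : HasItinerary g P (h y) := by
  obtain ⟨hf, hg, hcomm⟩ := hfg
  intro n
  have hsemi : Function.Semiconj h (hf.restrict f _ _) (hg.restrict g _ _) := congrFun hcomm
  have key := (hsemi.iterate_right n) y
  rw [MapsTo.iterate_restrict, MapsTo.iterate_restrict] at key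
  have : g^[n] (h y) = (h ((hf.iterate n).restrict _ _ _ y) : ℝ) := by
    rw [key, MapsTo.val_restrict_apply]
  rw [this]
  exact ⟨fun hp => hl _ ((hy n).1 hp), fun hp => hr _ ((hy n).2 hp)⟩

/-! ### Negative exponent for the quadratic map -/

theorem sq_prod_quadMap_mul (x : ℝ) (n : ℕ) :
    (∏ i ∈ Finset.range n, (4 - 8 * quadMap^[i] x)) ^ 2 * (x * (1 - x)) =
      4 ^ n * (quadMap^[n] x * (1 - quadMap^[n] x)) := by
  induction n with
  | zero => simp
  | succ n ih =>
    rw [Finset.prod_range_succ, Function.iterate_succ_apply']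
    have := quadMap_deriv_sq_mul (quadMap^[n] x)
    linear_combination (4 - 8 * quadMap^[n] x) ^ 2 * ih + 4 ^ n * this

/-- Along an orbit segment in the left half the quantity `x / (1 - x)` grows at least by the
factor `4` in each step. -/
theorem four_pow_mul_le_of_iterate_le_half {x : ℝ} (hx : x ∈ Icc (0 : ℝ) 1) (m : ℕ)
    (h : ∀ i ≤ m, quadMap^[i] x ≤ 1 / 2) : 4 ^ m * x ≤ 1 := by
  have hI : ∀ i, quadMap^[i] x ∈ Icc (0 : ℝ) 1 := fun i =>
    isUnimodal_quadMap.mapsTo.iterate i hx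
  have key : ∀ i ≤ m, 4 ^ i * x * (1 - quadMap^[i] x) ≤ quadMap^[i] x * (1 - x) := by
    intro i
    induction i with
    | zero => simp
    | succ i ih =>
      intro hi
      have ih := ih (by omega)
      have hi0 := (hI i).1
      have hi1 := h i (by omega)
      have hn1 := (hI (i + 1)).2
      have hx1 : 0 ≤ 1 - x := sub_nonneg.2 hx.2
      rw [Function.iterate_succ_apply'] at hn1 ⊢
      set u := quadMap^[i] x
      have hpos : 0 < 1 - u := by linarith
      -- The difference of the two sides is 4u²(2 - 3u).
      have step : 4 * u * (1 - quadMap u) ≤ quadMap u * (1 - u) := by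
        have : 0 ≤ u * (u * (2 - 3 * u)) := mul_nonneg hi0 (mul_nonneg hi0 (by linarith))
        unfold quadMap
        nlinarith
      refine le_of_mul_le_mul_right ?_ hpos
      have h1 := mul_le_mul_of_nonneg_left ih (mul_nonneg zero_le_four (sub_nonneg.2 hn1))
      have h2 := mul_le_mul_of_nonneg_left step hx1
      rw [pow_succ]
      linarith
  have h1 := key m le_rfl
  have h2 := h m le_rfl
  have h3 : (0 : ℝ) ≤ 4 ^ m * x := mul_nonneg (by positivity) hx.1
  nlinarith [hx.1, hx.2, (hI m).1]

/-- The times `n ∈ [32 * 8 ^ k, 65 * 8 ^ k)` for some `k`. -/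
def IsLeftTime (n : ℕ) : Prop := ∃ k, 32 * 8 ^ k ≤ n ∧ n < 65 * 8 ^ k

theorem eight_pow_le_or_le (j k : ℕ) : 8 ^ j ≤ 8 ^ k ∨ 8 * 8 ^ k ≤ 8 ^ j := by
  rcases le_or_gt j k with h | h
  · exact Or.inl (Nat.pow_le_pow_right (by norm_num) h)
  · refine Or.inr ?_
    rw [← pow_succ']
    exact Nat.pow_le_pow_right (by norm_num) h

/-- The preceding left block ends at 65 · 8^(k-1), which is less than 9 · 8^k. -/
theorem not_isLeftTime_of_lt {n k : ℕ} (h1 : 9 * 8 ^ k ≤ n) (h2 : n < 32 * 8 ^ k) :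
    ¬ IsLeftTime n := by
  rintro ⟨j, hj1, hj2⟩
  rcases eight_pow_le_or_le k j with h | h <;> omega

theorem not_isLeftTime_of_le {n k : ℕ} (h1 : 65 * 8 ^ k ≤ n) (h2 : n < 256 * 8 ^ k) :
    ¬ IsLeftTime n := by
  rintro ⟨j, hj1, hj2⟩
  rcases eight_pow_le_or_le j k with h | h <;> omega

theorem not_isLeftTime_of_lt_nine {n : ℕ} (hn : n < 9) : ¬ IsLeftTime n := by
  rintro ⟨j, hj1, hj2⟩
  have := Nat.one_le_pow j 8 (by norm_num)
  omega

theorem lowerLyapunov_quadMap_neg {y : ℝ} (hy : y ∈ Icc (0 : ℝ) 1)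
    (h : HasItinerary quadMap IsLeftTime y) : lowerLyapunov quadMap (Icc 0 1) y < 0 := by
  have h0 : 1 / 2 ≤ y := (h 0).2 (not_isLeftTime_of_lt_nine (by norm_num))
  have h1 : 1 / 2 ≤ quadMap y := (h 1).2 (not_isLeftTime_of_lt_nine (by norm_num))
  -- Two initial right symbols keep y away from 0 and 1, so w(y) can be divided out.
  have hw : 0 < y * (1 - y) := by
    unfold quadMap at h1
    linarith
  have hlog : 0 < Real.log 2 := Real.log_pos one_lt_two
  -- At n = 32B the squared derivative is at most 2^(-B) = 2^(-n/32). One factor 2^B of 4^B absorbs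
  -- the constant 4/w(y).
  refine lowerLyapunov_neg_of_frequently (c := Real.log 2 / 64) (by positivity) ?_
  have htend : Tendsto (fun k : ℕ => 8 ^ k) atTop atTop :=
    tendsto_pow_atTop_atTop_of_one_lt (by norm_num)
  have htend' : Tendsto (fun k : ℕ => 32 * 8 ^ k) atTop atTop :=
    htend.const_mul_atTop' (by norm_num)
  have hlarge : ∀ᶠ k : ℕ in atTop, 4 / (y * (1 - y)) ≤ (2 : ℝ) ^ (8 ^ k) :=
    ((tendsto_pow_atTop_atTop_of_one_lt (one_lt_two (α := ℝ))).comp htend).eventually_ge_atTop _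
  refine htend'.frequently (hlarge.frequently.mono fun k hk => ?_)
  rw [derivWithin_iterate_eq_prod hasDerivAt_quadMap _ hy]
  have hB := Nat.one_le_pow k 8 (by norm_num)
  set B := 8 ^ k
  have hxI : quadMap^[32 * B] y ∈ Icc (0 : ℝ) 1 := isUnimodal_quadMap.mapsTo.iterate _ hy
  have hsmall := four_pow_mul_le_of_iterate_le_half hxI (33 * B - 1) fun i hi => by
    rw [← Function.iterate_add_apply]
    exact (h _).1 ⟨k, by change 32 * B ≤ _; omega, by change _ < 65 * B; omega⟩
  have hsq := sq_prod_quadMap_mul y (32 * B)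
  set D := ∏ i ∈ Finset.range (32 * B), (4 - 8 * quadMap^[i] y)
  have hpow : (4 : ℝ) ^ (32 * B) * 4 ^ B = 4 * 4 ^ (33 * B - 1) := by
    rw [← pow_add, ← pow_succ']
    congr 1
    omega
  have h4 : (4 : ℝ) ^ B = 2 ^ B * 2 ^ B := by
    rw [← mul_pow]
    norm_num
  have h2 : (0 : ℝ) < 2 ^ B := by positivity
  rw [div_le_iff₀ hw] at hk
  have hD : D ^ 2 * 2 ^ B ≤ 1 := by
    have e1 : D ^ 2 * (y * (1 - y)) * 4 ^ B ≤ 4 := by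
      have : quadMap^[32 * B] y * (1 - quadMap^[32 * B] y) ≤ quadMap^[32 * B] y :=
        mul_le_of_le_one_right hxI.1 (by linarith [hxI.1])
      calc D ^ 2 * (y * (1 - y)) * 4 ^ B
          = 4 * 4 ^ (33 * B - 1) * (quadMap^[32 * B] y * (1 - quadMap^[32 * B] y)) := by
            rw [hsq, ← hpow]
            ring
        _ ≤ 4 * 4 ^ (33 * B - 1) * quadMap^[32 * B] y :=
            mul_le_mul_of_nonneg_left this (by positivity)
        _ ≤ 4 := by linarith
    have e2 : D ^ 2 * 2 ^ B * (2 ^ B * (y * (1 - y))) ≤ 1 * (2 ^ B * (y * (1 - y))) := by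
      rw [h4] at e1
      linarith
    exact le_of_mul_le_mul_right e2 (by positivity)
  refine abs_le_of_sq_le_sq ?_ (Real.exp_pos _).le
  have hexp : Real.exp (-(Real.log 2 / 64) * ((32 * B : ℕ) : ℝ)) ^ 2 * 2 ^ B = 1 := by
    rw [← Real.exp_nat_mul, ← Real.exp_log (zero_lt_two (α := ℝ)), ← Real.exp_nat_mul,
      ← Real.exp_add, Real.exp_log zero_lt_two, Real.exp_eq_one_iff]
    push_cast
    ring
  exact le_of_mul_le_mul_right (hD.trans_eq hexp.symm) h2

/-! ### Positive exponent for the sine map -/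

section Sine

variable {z : ℝ}

theorem iterate_add_sineMap_le (hz : z ∈ Icc (0 : ℝ) 1) (n r : ℕ) :
    sineMap^[n + r] z ≤ Real.pi ^ r * sineMap^[n] z := by
  induction r with
  | zero => simp
  | succ r ih =>
    rw [← add_assoc, Function.iterate_succ_apply', pow_succ', mul_assoc]
    exact (sineMap_le_pi_mul (mapsTo_sineMap.iterate (n + r) hz).1).trans
      (mul_le_mul_of_nonneg_left ih Real.pi_pos.le)

/-- A point too close to 0 or to 1 could not reach the right half in time, as the distance to 0
grows at most by the factor π per step. -/
theorem one_le_pi_pow_mul_of_half_le_iterate (hz : z ∈ Icc (0 : ℝ) 1) {n r : ℕ}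
    (h : 1 / 2 ≤ sineMap^[n + (r + 1)] z) :
    1 ≤ 4 * Real.pi ^ (r + 1) * (sineMap^[n] z * (1 - sineMap^[n] z)) := by
  have hn : sineMap^[n] z ∈ Icc (0 : ℝ) 1 := mapsTo_sineMap.iterate n hz
  have h1 := h.trans (iterate_add_sineMap_le hz n (r + 1))
  have h2 : 1 / 2 ≤ Real.pi ^ (r + 1) * (1 - sineMap^[n] z) := by
    rw [add_comm r, ← add_assoc] at h
    refine (h.trans (iterate_add_sineMap_le hz (n + 1) r)).trans ?_
    rw [Function.iterate_succ_apply', pow_succ, mul_assoc]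
    exact mul_le_mul_of_nonneg_left (sineMap_le_pi_mul_one_sub hn.2)
      (pow_nonneg Real.pi_pos.le r)
  rcases le_total (1 / 2) (sineMap^[n] z) with h3 | h3 <;> nlinarith

/-- Here `W` stands for w(g^n z) and `D` for the derivative. Since n ≥ 32B - 1, the loss exceeds the
gain π^n by at most a factor 4π^(B+2), while (9/8)^(23B) ≥ (4π)^B. This leaves 4^B ≤ 64 D², and B ≥
8 absorbs the 64. -/
theorem two_pow_le_sq_of_pi_pow_mul_le {B n : ℕ} {D W : ℝ} (hB : 8 ≤ B) (h1 : 32 * B ≤ n + 1)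
    (h2 : n + 1 < 65 * B) (hW0 : 0 ≤ W)
    (hw : 1 ≤ 4 * Real.pi ^ ((65 * B - n - 1) + 1) * W)
    (hD : Real.pi ^ (9 * B) * (9 / 8 * Real.pi) ^ (23 * B - 1) * Real.pi ^ (n + 1 - 32 * B) * W ≤
      D ^ 2) :
    2 ^ B ≤ D ^ 2 := by
  have hpi := Real.pi_gt_three
  have hcoef : Real.pi ^ (9 * B) * (9 / 8 * Real.pi) ^ (23 * B - 1) *
      Real.pi ^ (n + 1 - 32 * B) = Real.pi ^ n * (9 / 8) ^ (23 * B - 1) := by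
    have : Real.pi ^ (9 * B) * Real.pi ^ (23 * B - 1) * Real.pi ^ (n + 1 - 32 * B) =
        Real.pi ^ n := by
      rw [← pow_add, ← pow_add]
      congr 1
      omega
    rw [mul_pow, ← this]
    ring
  rw [hcoef] at hD
  have hr : Real.pi ^ ((65 * B - n - 1) + 1) ≤ Real.pi ^ (B + 2) * Real.pi ^ n := by
    rw [← pow_add]
    exact pow_le_pow_right₀ (by linarith) (by omega)
  have e4 : (9 / 8 : ℝ) ^ (23 * B - 1) ≤ 4 * Real.pi ^ (B + 2) * D ^ 2 := by
    calc (9 / 8 : ℝ) ^ (23 * B - 1)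
        ≤ (9 / 8 : ℝ) ^ (23 * B - 1) * (4 * Real.pi ^ ((65 * B - n - 1) + 1) * W) :=
          le_mul_of_one_le_right (by positivity) hw
      _ ≤ (9 / 8 : ℝ) ^ (23 * B - 1) * (4 * (Real.pi ^ (B + 2) * Real.pi ^ n) * W) := by
          gcongr
      _ = 4 * Real.pi ^ (B + 2) * (Real.pi ^ n * (9 / 8) ^ (23 * B - 1) * W) := by ring
      _ ≤ 4 * Real.pi ^ (B + 2) * D ^ 2 := by gcongr
  have hpi2 : Real.pi < 3.15 := Real.pi_lt_d2
  have e5 : (4 * Real.pi) ^ B ≤ 9 / 8 * (9 / 8 : ℝ) ^ (23 * B - 1) := by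
    rw [← pow_succ', show 23 * B - 1 + 1 = 23 * B by omega, pow_mul]
    gcongr
    norm_num
    linarith
  have e6 : 2 ^ B * 2 ^ B ≤ 64 * D ^ 2 := by
    have hpB : 0 < Real.pi ^ B := by positivity
    refine le_of_mul_le_mul_right ?_ hpB
    rw [← mul_pow, ← mul_pow]
    norm_num
    have h10 : Real.pi ^ 2 ≤ 10 := by nlinarith
    have : Real.pi ^ 2 * (Real.pi ^ B * D ^ 2) ≤ 10 * (Real.pi ^ B * D ^ 2) := by gcongr
    have h0 : 0 ≤ Real.pi ^ B * D ^ 2 := by positivity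
    rw [pow_add] at e4
    linarith
  have e7 : (64 : ℝ) ≤ 2 ^ B := by
    calc (64 : ℝ) ≤ 2 ^ 8 := by norm_num
      _ ≤ 2 ^ B := pow_le_pow_right₀ one_le_two hB
  have h2B : (0 : ℝ) < 2 ^ B := by positivity
  nlinarith [sq_nonneg D]

theorem sq_prod_ge_of_forall_half_le (hz : z ∈ Icc (0 : ℝ) 1) {n B : ℕ} (hB : 8 ≤ B)
    (h1 : 32 * B ≤ n + 1) (h2 : n + 1 < 65 * B)
    (hright : ∀ i, 9 * B ≤ i → i < 32 * B → 1 / 2 ≤ sineMap^[i] z)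
    (hret : 1 / 2 ≤ sineMap^[65 * B] z) :
    2 ^ B ≤ (∏ i ∈ Finset.range n, Real.pi * Real.cos (Real.pi * sineMap^[i] z)) ^ 2 := by
  have hI : ∀ i, sineMap^[i] z ∈ Icc (0 : ℝ) 1 := fun i => mapsTo_sineMap.iterate i hz
  have hw := one_le_pi_pow_mul_of_half_le_iterate (n := n) (r := 65 * B - n - 1) hz
    (by rwa [show n + ((65 * B - n - 1) + 1) = 65 * B by omega])
  have e1 := pow_le_sq_prod_mul_of_expanding (f := sineMap)
    (f' := fun x => Real.pi * Real.cos (Real.pi * x)) (x := z) Real.pi_pos.le (9 * B)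
    fun i _ => le_sineMap_deriv_sq_mul (hI i)
  -- The factor 9/8 requires the image, not the point, to be at least 1/2; hence one step fewer than
  -- the 23B right times.
  have e2 := le_sq_prod_mul_of_expanding (f := sineMap)
    (f' := fun x => Real.pi * Real.cos (Real.pi * x)) (x := z) (a := 9 * B)
    (c := 9 / 8 * Real.pi) (by positivity) (by positivity) (23 * B - 1) e1 fun i hi1 hi2 => le_sineMap_deriv_sq_mul_of_half_le (hI i) (by
      rw [← Function.iterate_succ_apply' sineMap]
      exact hright _ (by omega) (by omega))
  have e3 := le_sq_prod_mul_of_expanding (f := sineMap)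
    (f' := fun x => Real.pi * Real.cos (Real.pi * x)) (x := z) (c := Real.pi) (by positivity) (by positivity)
    (n + 1 - 32 * B) e2 fun i _ _ => le_sineMap_deriv_sq_mul (hI i)
  rw [show 9 * B + (23 * B - 1) + (n + 1 - 32 * B) = n by omega] at e3
  exact two_pow_le_sq_of_pi_pow_mul_le hB h1 h2 (mul_nonneg (hI n).1 (sub_nonneg.2 (hI n).2)) hw
    (e3.trans (mul_le_of_le_one_right (sq_nonneg _) (by nlinarith [hz.1, hz.2])))

theorem sq_prod_ge_of_add_one_lt (hz : z ∈ Icc (0 : ℝ) 1)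
    (h : HasItinerary sineMap IsLeftTime z) {n k : ℕ} (hk : 1 ≤ k) (h1 : 32 * 8 ^ k ≤ n + 1)
    (h2 : n + 1 < 65 * 8 ^ k) :
    2 ^ (8 ^ k) ≤
      (∏ i ∈ Finset.range n, Real.pi * Real.cos (Real.pi * sineMap^[i] z)) ^ 2 :=
  sq_prod_ge_of_forall_half_le hz (Nat.le_self_pow (by omega) 8) h1 h2
    (fun i hi1 hi2 => (h i).2 (not_isLeftTime_of_lt hi1 hi2))
    ((h _).2 (not_isLeftTime_of_le le_rfl
      (Nat.mul_lt_mul_of_pos_right (by norm_num) (by positivity))))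

theorem sq_prod_ge_of_not_isLeftTime (hz : z ∈ Icc (0 : ℝ) 1)
    (h : HasItinerary sineMap IsLeftTime z) {n : ℕ} (hn : 7 ≤ n) (h1 : ¬ IsLeftTime (n + 1)) :
    2 ^ n ≤ (∏ i ∈ Finset.range n, Real.pi * Real.cos (Real.pi * sineMap^[i] z)) ^ 2 := by
  have hpi := Real.pi_gt_three
  have hpi2 : Real.pi < 3.15 := Real.pi_lt_d2
  have hI : ∀ i, sineMap^[i] z ∈ Icc (0 : ℝ) 1 := fun i => mapsTo_sineMap.iterate i hz
  have hw := one_le_pi_pow_mul_of_half_le_iterate (n := n) (r := 0) hz ((h _).2 h1)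
  have e1 := pow_le_sq_prod_mul_of_expanding (f := sineMap)
    (f' := fun x => Real.pi * Real.cos (Real.pi * x)) (x := z) Real.pi_pos.le n
    fun i _ => le_sineMap_deriv_sq_mul (hI i)
  set D := ∏ i ∈ Finset.range n, Real.pi * Real.cos (Real.pi * sineMap^[i] z)
  set W := sineMap^[n] z * (1 - sineMap^[n] z)
  have hD : Real.pi ^ n * W ≤ D ^ 2 :=
    e1.trans (mul_le_of_le_one_right (sq_nonneg _) (by nlinarith [hz.1, hz.2]))
  have e2 : (2 : ℝ) ^ n * 16 ≤ Real.pi ^ n := by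
    calc (2 : ℝ) ^ n * 16 ≤ 2 ^ n * (3 / 2) ^ n := by
          gcongr
          calc (16 : ℝ) ≤ (3 / 2) ^ 7 := by norm_num
            _ ≤ (3 / 2) ^ n := pow_le_pow_right₀ (by norm_num) hn
      _ = 3 ^ n := by rw [← mul_pow]; norm_num
      _ ≤ Real.pi ^ n := by gcongr
  have hW0 : 0 ≤ W := mul_nonneg (hI n).1 (sub_nonneg.2 (hI n).2)
  have hw' : 1 ≤ 16 * W := by
    rw [zero_add, pow_one] at hw
    nlinarith
  calc (2 : ℝ) ^ n ≤ 2 ^ n * (16 * W) := le_mul_of_one_le_right (by positivity) hw'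
    _ = 2 ^ n * 16 * W := by ring
    _ ≤ Real.pi ^ n * W := by gcongr
    _ ≤ D ^ 2 := hD

theorem lowerLyapunov_sineMap_pos (hz : z ∈ Icc (0 : ℝ) 1)
    (h : HasItinerary sineMap IsLeftTime z) : 0 < lowerLyapunov sineMap (Icc 0 1) z := by
  have hlog : 0 < Real.log 2 := Real.log_pos one_lt_two
  -- The bound is (Dg^n)² ≥ 2^m with n ≤ 65m. The threshold 255 ensures k ≥ 1, so that B ≥ 8.
  refine lowerLyapunov_pos_of_eventually (c := Real.log 2 / 130) (by positivity) ?_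
  filter_upwards [eventually_ge_atTop 255] with n hn
  rw [derivWithin_iterate_eq_prod hasDerivAt_sineMap _ hz]
  obtain ⟨m, hnm, hm⟩ : ∃ m : ℕ, n ≤ 65 * m ∧ 2 ^ m ≤
      (∏ i ∈ Finset.range n, Real.pi * Real.cos (Real.pi * sineMap^[i] z)) ^ 2 := by
    -- With B = 8^k this means 32B ≤ n + 1 < 256B: time n + 1 lies in a left block or in the right
    -- gap after it. Time n + 1 matters because a right symbol there bounds w(g^n z) from below.
    obtain ⟨k, hk1, hk2⟩ : ∃ k, 8 ^ k ≤ (n + 1) / 32 ∧ (n + 1) / 32 < 8 ^ (k + 1) :=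
      ⟨Nat.log 8 ((n + 1) / 32), Nat.pow_log_le_self 8 (by omega),
        Nat.lt_pow_succ_log_self (by norm_num) _⟩
    rw [pow_succ] at hk2
    have hk : 1 ≤ k := by
      by_contra hk
      obtain rfl : k = 0 := by omega
      rw [pow_zero] at hk2
      omega
    rcases lt_or_ge (n + 1) (65 * 8 ^ k) with hlt | hge
    · exact ⟨8 ^ k, by omega, sq_prod_ge_of_add_one_lt hz h hk (by omega) hlt⟩
    · exact ⟨n, by omega, sq_prod_ge_of_not_isLeftTime hz h (by omega)
        (not_isLeftTime_of_le hge (by omega))⟩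
  refine le_trans ?_ (Real.sqrt_sq_eq_abs _).le
  refine Real.le_sqrt_of_sq_le (le_trans ?_ hm)
  rw [← Real.exp_nat_mul, ← Real.exp_log (zero_lt_two (α := ℝ)), ← Real.exp_nat_mul,
    Real.exp_log zero_lt_two, Real.exp_le_exp]
  have : (n : ℝ) ≤ 65 * m := by exact_mod_cast hnm
  push_cast
  nlinarith

end Sine

theorem proposition1 :
    IsUnimodal quadMap 0 1 ∧ IsUnimodal sineMap 0 1 ∧
    ∃ h : Icc (0 : ℝ) 1 ≃ₜ Icc (0 : ℝ) 1, IsTopConjugacy quadMap sineMap h ∧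
      ∃ y : Icc (0 : ℝ) 1,
        lowerLyapunov quadMap (Icc 0 1) (y : ℝ) < 0 ∧
        0 < lowerLyapunov sineMap (Icc 0 1) (h y : ℝ) ∧
        ¬ IsAsymptoticToNeutral quadMap (Icc 0 1) (y : ℝ) ∧
        ¬ IsAsymptoticToNeutral sineMap (Icc 0 1) (h y : ℝ) := by
  obtain ⟨h, hconj, hl, hr⟩ := exists_isTopConjugacy_quadMap_sineMap
  obtain ⟨y, hy, hyP⟩ := exists_hasItinerary_quadMap IsLeftTime
  exact ⟨isUnimodal_quadMap, isUnimodal_sineMap, h, hconj, ⟨y, hy⟩,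
    lowerLyapunov_quadMap_neg hy hyP,
    lowerLyapunov_sineMap_pos (h ⟨y, hy⟩).2 (HasItinerary.of_isTopConjugacy hconj hl hr hyP),
    not_isAsymptoticToNeutral_quadMap _, not_isAsymptoticToNeutral_sineMap _⟩
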